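/- Let $n$ be a non-negative integer and let $C$ be a symmetric positive semidefinite infinite covariance matrix (regarded as an operator on the real sequence space $\ell^2$) with $\operatorname{Tr}(C)=\sum_j C_{jj}<\infty$. Let $G$ be a random $\infty\times n$ matrix whose $n$ columns are independent random elements of $\ell^2$, each with the centered Gaussian distribution $\mathcal N(0,C)$ (that is, $\langle x,g\rangle\sim\mathcal N(0,\langle x,Cx\rangle)$ for every $x\in\ell^2$ and every column $g$); $G$ acts as the operator $\mathbb R^n\to\ell^2$, $x\mapsto\sum_i x_i g_i$, where $g_1,\dots,g_n$ are its columns. Let $D\subseteq\mathbb R^d$, and let $S:\ell^2\to L^2(D)$ and $T:\ell^2\to\mathbb R^n$ be deterministic Hilbert--Schmidt operators. Then $\|SGT\|$ is integrable and $$\mathbb E\|SGT\|\le\Big(\|C^{1/2}\|_{\mathrm{HS}}\,\|T\|+\|C^{1/2}\|\,\|T\|_{\mathrm{HS}}\Big)\|S\|.$$ Here $\|\cdot\|$ is the operator norm, $\|A\|_{\mathrm{HS}}=\big(\sum_j\|Ae_j\|^2\big)^{1/2}$ with $(e_j)$ the standard basis of $\ell^2$ is the Hilbert--Schmidt norm,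 and $C^{1/2}$ is the positive semidefinite square root of $C$. -/

import Mathlib

open MeasureTheory ProbabilityTheory
open scoped RealInnerProductSpace

/-- The real sequence space `ℓ²`. -/
abbrev Ell2 : Type := lp (fun _ : ℕ => ℝ) 2

/-- `ℓ²` carries its Borel σ-algebra. -/
noncomputable instance instMeasurableSpaceEll2 : MeasurableSpace Ell2 := borel Ell2

instance instBorelSpaceEll2 : BorelSpace Ell2 := ⟨rfl⟩

/-- The `j`-th standard unit vector of `ℓ²`. -/
noncomputable def unitVec (j : ℕ) : Ell2 := lp.single 2 j (1 : ℝ)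

section HilbertSchmidt

variable {H : Type*} [NormedAddCommGroup H] [InnerProductSpace ℝ H]

/-- A bounded operator `A : ℓ² → H`, equivalently the (quasi)matrix with columns `A e₀, A e₁, …`, is
Hilbert–Schmidt if its columns are square summable. -/
def IsHilbertSchmidt (A : Ell2 →L[ℝ] H) : Prop :=
  Summable fun j : ℕ => ‖A (unitVec j)‖ ^ 2

/-- The Hilbert–Schmidt norm `(∑ⱼ ‖A eⱼ‖²)^{1/2}`, meaningful for Hilbert–Schmidt operators. -/
noncomputable def hsNorm (A : Ell2 →L[ℝ] H) : ℝ :=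
  Real.sqrt (∑' j : ℕ, ‖A (unitVec j)‖ ^ 2)

end HilbertSchmidt

/-- An infinite symmetric positive semidefinite covariance matrix `C`, viewed as a bounded operator
on `ℓ²` with entries `C i j = ⟪eᵢ, C eⱼ⟫`, of finite trace `∑ⱼ C j j`. -/
structure IsTraceClassCovariance (C : Ell2 →L[ℝ] Ell2) : Prop where
  isPositive : C.IsPositive
  summable_trace : Summable fun j : ℕ => ⟪unitVec j, C (unitVec j)⟫

section SquareRoot

theorem summable_catalan_div_four_pow :
    Summable (fun n : ℕ => (catalan n : ℝ) / 4 ^ n) ∧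
      ∑' n : ℕ, (catalan n : ℝ) / 4 ^ n ≤ 2 := by
  have key : ∀ n : ℕ, ∑ i ∈ Finset.range n, (catalan i : ℝ) / 4 ^ i
      = 2 - 2 * ((Nat.centralBinom n : ℝ) / 4 ^ n) := by
    intro n
    induction n with
    | zero => simp
    | succ n ih =>
      have h1 : ((n : ℝ) + 1) * Nat.centralBinom (n + 1)
          = 2 * (2 * n + 1) * Nat.centralBinom n := by
        exact_mod_cast Nat.succ_mul_centralBinom_succ n
      have h2 : ((n : ℝ) + 1) * catalan n = Nat.centralBinom n := by
        exact_mod_cast succ_mul_catalan_eq_centralBinom n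
      have hn : (n : ℝ) + 1 ≠ 0 := by positivity
      have h3 : (Nat.centralBinom (n + 1) : ℝ) = 2 * (2 * n + 1) * catalan n := by
        apply mul_left_cancel₀ hn
        rw [h1, ← h2]; ring
      rw [Finset.sum_range_succ, ih, h3, ← h2, pow_succ]
      field_simp
      ring
  have hnn : ∀ n : ℕ, 0 ≤ (catalan n : ℝ) / 4 ^ n := fun n => by positivity
  have hle : ∀ n : ℕ, ∑ i ∈ Finset.range n, (catalan i : ℝ) / 4 ^ i ≤ 2 := by
    intro n
    rw [key n]
    have : (0 : ℝ) ≤ (Nat.centralBinom n : ℝ) / 4 ^ n := by positivity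
    linarith
  exact ⟨summable_of_sum_range_le hnn hle, Real.tsum_le_of_sum_range_le hnn hle⟩

variable {H : Type*} [NormedAddCommGroup H] [InnerProductSpace ℝ H] [CompleteSpace H]

theorem exists_sqrt_one_sub (A : H →L[ℝ] H) (hA : IsSelfAdjoint A) (hA1 : ‖A‖ ≤ 1) :
    ∃ R : H →L[ℝ] H, R.IsPositive ∧ R * R = 1 - A := by
  obtain ⟨hs, hs2⟩ := summable_catalan_div_four_pow
  set f : ℕ → (H →L[ℝ] H) := fun n => ((catalan n : ℝ) / 4 ^ n) • A ^ n with hf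
  have hpow : ∀ n : ℕ, ‖A ^ n‖ ≤ 1 := fun n => by
    rcases Nat.eq_zero_or_pos n with rfl | hn
    · rw [pow_zero]; exact ContinuousLinearMap.norm_id_le
    · exact (norm_pow_le' A hn).trans (pow_le_one₀ (norm_nonneg _) hA1)
  have hfn : ∀ n, ‖f n‖ ≤ (catalan n : ℝ) / 4 ^ n := fun n => by
    have h0 : (0 : ℝ) ≤ (catalan n : ℝ) / 4 ^ n := by positivity
    rw [hf]; simp only [norm_smul, Real.norm_of_nonneg h0]
    exact mul_le_of_le_one_right h0 (hpow n)
  have hfs : Summable (fun n => ‖f n‖) := Summable.of_nonneg_of_le (fun _ => norm_nonneg _) hfn hs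
  set F : H →L[ℝ] H := ∑' n, f n with hF
  have hFsum : HasSum f F := hfs.of_norm.hasSum
  have hFnorm : ‖F‖ ≤ 2 := (norm_tsum_le_tsum_norm hfs).trans
    ((hfs.tsum_le_tsum hfn hs).trans hs2)
  have hFsa : IsSelfAdjoint F := by
    have hst : ∀ n, star (f n) = f n := fun n => by
      simp only [hf, star_smul, star_trivial, star_pow, hA.star_eq]
    have : star F = F := by
      rw [hF, tsum_star]
      simp only [hst]
    exact this
  have hAF : Commute A F := by
    have hc : ∀ n, A * f n = f n * A := fun n => by
      simp only [hf, mul_smul_comm, smul_mul_assoc, ← pow_succ, ← pow_succ']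
    have h1 := hFsum.mul_left A
    have h2 := hFsum.mul_right A
    simp only [hc] at h1
    exact h1.unique h2
  have hquad : F = 1 + (1 / 4 : ℝ) • (A * (F * F)) := by
    have h1 : F * F = ∑' n, ∑ kl ∈ Finset.HasAntidiagonal.antidiagonal n, f kl.1 * f kl.2 :=
      tsum_mul_tsum_eq_tsum_sum_antidiagonal_of_summable_norm hfs hfs
    have h2 : Summable (fun n => ∑ kl ∈ Finset.HasAntidiagonal.antidiagonal n, f kl.1 * f kl.2) :=
      (summable_norm_sum_mul_antidiagonal_of_summable_norm hfs hfs).of_norm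
    have h3 : ∀ n, f (n + 1)
        = (1 / 4 : ℝ) • (A * ∑ kl ∈ Finset.HasAntidiagonal.antidiagonal n, f kl.1 * f kl.2) := fun n => by
      have h4 : ∀ kl ∈ Finset.HasAntidiagonal.antidiagonal n, f kl.1 * f kl.2
          = ((catalan kl.1 * catalan kl.2 : ℝ) / 4 ^ n) • A ^ n := by
        intro kl hkl
        rw [Finset.HasAntidiagonal.mem_antidiagonal] at hkl
        simp only [hf, smul_mul_smul_comm, ← pow_add, hkl]
        congr 1
        rw [← hkl, pow_add]
        field_simp
      rw [Finset.sum_congr rfl h4, ← Finset.sum_smul, mul_smul_comm, smul_smul, ← pow_succ']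
      simp only [hf]
      congr 1
      rw [catalan_succ', ← Finset.sum_div]
      push_cast
      rw [pow_succ]
      field_simp
    rw [h1, ← h2.tsum_mul_left, ← (h2.mul_left A).tsum_const_smul]
    simp only [← h3]
    rw [hF, hfs.of_norm.tsum_eq_zero_add]
    simp [hf]
  refine ⟨1 - (1 / 2 : ℝ) • (A * F), ?_, ?_⟩
  · have hsa : IsSelfAdjoint (1 - (1 / 2 : ℝ) • (A * F)) := by
      have h1 : IsSelfAdjoint (A * F) := by
        rw [IsSelfAdjoint, star_mul, hA.star_eq, hFsa.star_eq]; exact hAF.eq.symm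
      exact (IsSelfAdjoint.one _).sub ((IsSelfAdjoint.all (1 / 2 : ℝ)).smul h1)
    rw [ContinuousLinearMap.isPositive_def']
    refine ⟨hsa, fun x => ?_⟩
    have hn : ‖(1 / 2 : ℝ) • (A * F)‖ ≤ 1 := by
      rw [norm_smul]
      have : ‖A * F‖ ≤ 1 * 2 := (norm_mul_le _ _).trans
        (mul_le_mul hA1 hFnorm (norm_nonneg _) zero_le_one)
      norm_num
      linarith
    have hx : ⟪((1 / 2 : ℝ) • (A * F)) x, x⟫ ≤ ‖x‖ * ‖x‖ :=
      (real_inner_le_norm _ _).trans (mul_le_mul_of_nonneg_right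
        (by simpa using ContinuousLinearMap.le_of_opNorm_le _ hn x) (norm_nonneg _))
    rw [ContinuousLinearMap.reApplyInnerSelf_apply]
    simp only [sub_apply, inner_sub_left, one_apply_eq_self,
      RCLike.re_to_real, real_inner_self_eq_norm_mul_norm]
    linarith
  · have hcm : A * F * (A * F) = A * (A * (F * F)) := by
      rw [mul_assoc, ← mul_assoc F A F, ← hAF.eq]; simp only [mul_assoc]
    have h4 : A * (F * F) = (4 : ℝ) • (F - 1) := by
      conv_rhs => rw [hquad]
      simp [smul_smul]
    have h5 : (1 - (1 / 2 : ℝ) • (A * F)) * (1 - (1 / 2 : ℝ) • (A * F))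
        = 1 - A * F + (1 / 4 : ℝ) • (A * F * (A * F)) := by
      simp only [sub_mul, mul_sub, one_mul, mul_one, smul_mul_smul_comm]
      module
    rw [h5, hcm, h4, mul_smul_comm, mul_sub, mul_one]
    module

theorem exists_positive_sqrt (C : H →L[ℝ] H) (hC : C.IsPositive) :
    ∃ R : H →L[ℝ] H, R.IsPositive ∧ R * R = C := by
  rcases eq_or_ne C 0 with rfl | h0
  · exact ⟨0, ContinuousLinearMap.isPositive_zero, by simp⟩
  have hc : 0 < ‖C‖ := norm_pos_iff.mpr h0
  have hsa : IsSelfAdjoint (1 - (‖C‖⁻¹ : ℝ) • C) :=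
    (IsSelfAdjoint.one _).sub ((IsSelfAdjoint.all (‖C‖⁻¹ : ℝ)).smul hC.isSelfAdjoint)
  have hn : ‖(1 : H →L[ℝ] H) - (‖C‖⁻¹ : ℝ) • C‖ ≤ 1 := by
    set B : H →L[ℝ] H := (‖C‖⁻¹ : ℝ) • C with hB
    have hBpos : B.IsPositive := hC.smul_of_nonneg (inv_nonneg.mpr hc.le)
    have hB1 : ‖B‖ ≤ 1 := by
      rw [hB, norm_smul, norm_inv, norm_norm, inv_mul_cancel₀ hc.ne']
    refine ContinuousLinearMap.opNorm_le_bound _ zero_le_one fun x => ?_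
    have h1 : 0 ≤ ⟪B (x - B x), x - B x⟫ := hBpos.inner_nonneg_left _
    have h2 : ⟪B (B x), x⟫ = ⟪B x, B x⟫ := hBpos.inner_left_eq_inner_right _ _
    have h3 : ⟪B (B x), B x⟫ ≤ ⟪B x, B x⟫ := by
      rw [real_inner_self_eq_norm_mul_norm]
      exact (real_inner_le_norm _ _).trans (mul_le_mul_of_nonneg_right
        (by simpa using ContinuousLinearMap.le_of_opNorm_le _ hB1 (B x)) (norm_nonneg _))
    have h4 : 0 ≤ ⟪B x, x⟫ := hBpos.inner_nonneg_left _
    simp only [map_sub, inner_sub_left, inner_sub_right, h2] at h1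
    have h5 : ‖x - B x‖ ^ 2 ≤ ‖x‖ ^ 2 := by
      rw [norm_sub_sq_real, real_inner_comm, ← real_inner_self_eq_norm_sq (B x)]
      linarith
    rw [one_mul]
    exact (sq_le_sq₀ (norm_nonneg _) (norm_nonneg _)).mp h5
  obtain ⟨R, hR, hRR⟩ := exists_sqrt_one_sub _ hsa hn
  refine ⟨Real.sqrt ‖C‖ • R, ?_, ?_⟩
  · exact hR.smul_of_nonneg (Real.sqrt_nonneg _)
  · rw [smul_mul_smul_comm, Real.mul_self_sqrt hc.le, hRR, sub_sub_cancel, smul_smul,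
      mul_inv_cancel₀ hc.ne', one_smul]

end SquareRoot

/-- The square root `C^{1/2}` of a positive operator `C` on a real Hilbert space: the (unique)
positive operator whose square is `C`. -/
noncomputable def posSqrt {H : Type*} [NormedAddCommGroup H] [InnerProductSpace ℝ H]
    [CompleteSpace H] (C : H →L[ℝ] H) (hC : C.IsPositive) : H →L[ℝ] H :=
  (exists_positive_sqrt C hC).choose

/-- The `∞ × n` matrix with columns `g₁, …, gₙ ∈ ℓ²`, as the operator `x ↦ ∑ᵢ xᵢ gᵢ` from `ℝⁿ` to
`ℓ²`. -/
noncomputable def colOp {n : ℕ} (g : Fin n → Ell2) : EuclideanSpace ℝ (Fin n) →L[ℝ] Ell2 :=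
  ∑ i : Fin n, (EuclideanSpace.proj i : EuclideanSpace ℝ (Fin n) →L[ℝ] ℝ).smulRight (g i)

/-- The measure `μ` on `ℓ²` is the Gaussian distribution `𝒩(0, C)`: for every `x ∈ ℓ²` the linear
functional `⟪x, ·⟫` has under `μ` the distribution `𝒩(0, ⟪x, C x⟫)`. -/
def IsCenteredGaussian (μ : Measure Ell2) (C : Ell2 →L[ℝ] Ell2) : Prop :=
  ∀ x : Ell2, μ.map (fun y => ⟪x, y⟫) = gaussianReal 0 (Real.toNNReal ⟪x, C x⟫)

/-- The random `∞ × n` matrix `G`, given by its columns, has distribution `𝒩(0, Iₙ ⊗ C)`: its columns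
are independent and each of them has distribution `𝒩(0, C)`. -/
structure IsGaussianMatrix {Ω : Type*} [MeasurableSpace Ω] (P : Measure Ω) {n : ℕ}
    (G : Ω → Fin n → Ell2) (C : Ell2 →L[ℝ] Ell2) : Prop where
  aemeasurable : ∀ i : Fin n, AEMeasurable (fun ω => G ω i) P
  law : ∀ i : Fin n, IsCenteredGaussian (P.map fun ω => G ω i) C
  indep : iIndepFun (fun i ω => G ω i) P

/-!
Only `E‖G T‖` has to be bounded, since `‖S G T‖ ≤ ‖S‖ ‖G T‖`. With `R = C^{1/2}`, the norm `‖G T‖` is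
the supremum over the unit ball of the Gaussian process `⟪y, G T x⟫`, whose covariance is the product
`⟪R y, R y'⟫ ⟪T x, T x'⟫`: it has the law of `⟪v ⊗ u, Z⟫` with `u = R y`, `v = T x` and `Z` standard
Gaussian. This process is compared with `‖v‖ ⟪u, W₁⟫ + ‖u‖ ⟪v, W₂⟫`, where `W₁` and `W₂` are independent
standard Gaussian vectors (`integral_iSup_inner_tensorVec_le`). The supremum of the second process is
at most `‖T‖ ‖R* W₁‖ + ‖R‖ ‖T* W₂‖`, and `E‖A* W‖ ≤ (E‖A* W‖²)^{1/2} = ‖A‖_HS`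
(`integral_norm_adjoint_le`).

The increments of the two processes are not comparable as they stand, because `‖u‖` and `‖v‖` vary.
They become so once `‖u‖ ‖v‖ γ` is added to the first one, with `γ` an independent standard Gaussian
variable; this can only increase the expected supremum (`integral_iSup_inner_le_prod`). The comparison
is then the Sudakov–Fernique inequality (`sudakov_fernique`). It is proved by replacing the maximum
with `logSumExp` and interpolating between the two families along `cos θ a + sin θ b`; by Gaussian
integration by parts (`integral_inner_mul_stdGaussian`) the derivative is a sum of the differences of
the squared increments with nonnegative weights.

All Gaussian vectors are finite-dimensional: the comparison is made for finitely many pairs `(x, y)`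
(`IsGaussianMatrix.integral_iSup_inner_colOp_le`), where only the span of the vectors `R y` matters, and
monotone convergence along a dense sequence of pairs gives the operator norm. This also yields the
integrability of `‖G T‖`.
-/

/-! ### Gaussian integration by parts -/

theorem hasDerivAt_gaussianPDFReal_zero_one (x : ℝ) :
    HasDerivAt (gaussianPDFReal 0 1) (-(x * gaussianPDFReal 0 1 x)) x := by
  have h : HasDerivAt (fun y : ℝ => (√(2 * Real.pi * (1 : NNReal)))⁻¹
      * Real.exp (-(y - 0) ^ 2 / (2 * (1 : NNReal))))
      ((√(2 * Real.pi * (1 : NNReal)))⁻¹ * (Real.exp (-(x - 0) ^ 2 / (2 * (1 : NNReal))) * (-x))) x := by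
    refine HasDerivAt.const_mul _ (HasDerivAt.exp ?_)
    have := (((hasDerivAt_id x).sub_const 0).pow 2).neg.div_const (2 * ((1 : NNReal) : ℝ))
    refine this.congr_deriv ?_
    simp
    ring
  have e : gaussianPDFReal 0 1 = fun y : ℝ => (√(2 * Real.pi * (1 : NNReal)))⁻¹
      * Real.exp (-(y - 0) ^ 2 / (2 * (1 : NNReal))) := by
    ext y; rw [gaussianPDFReal_def]
  rw [e]
  exact h.congr_deriv (by ring)

theorem integral_gaussianReal_zero_one (f : ℝ → ℝ) :
    ∫ x, f x ∂gaussianReal 0 1 = ∫ x, gaussianPDFReal 0 1 x * f x := by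
  rw [integral_gaussianReal_eq_integral_smul one_ne_zero]; rfl

theorem integrable_bounded_mul_gaussianPDFReal {f : ℝ → ℝ} {K : ℝ} (hf : Measurable f)
    (hK : ∀ x, |f x| ≤ K) : Integrable (fun x => f x * gaussianPDFReal 0 1 x) :=
  (integrable_gaussianPDFReal 0 1).bdd_mul hf.aestronglyMeasurable (Filter.Eventually.of_forall hK)

theorem integrable_id_mul_gaussianPDFReal : Integrable (fun x => x * gaussianPDFReal 0 1 x) := by
  have h : Integrable (fun x : ℝ => x) (gaussianReal 0 1) := IsGaussian.integrable_id
  rw [gaussianReal_of_var_ne_zero 0 one_ne_zero, integrable_withDensity_iff_integrable_smul₀'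
    (measurable_gaussianPDF 0 1).aemeasurable (by simp [gaussianPDF_lt_top])] at h
  simpa [toReal_gaussianPDF, mul_comm] using h

/-- Gaussian integration by parts on the line. -/
theorem integral_id_mul_gaussianReal {f f' : ℝ → ℝ} {K : ℝ} (hd : ∀ x, HasDerivAt f (f' x) x)
    (hf' : Measurable f') (hK : ∀ x, |f x| ≤ K) (hK' : ∀ x, |f' x| ≤ K) :
    ∫ x, x * f x ∂gaussianReal 0 1 = ∫ x, f' x ∂gaussianReal 0 1 := by
  have hf : Measurable f :=
    (continuous_iff_continuousAt.2 fun x => (hd x).continuousAt).measurable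
  have h1 : Integrable (fun x => f x * -(x * gaussianPDFReal 0 1 x)) :=
    (integrable_id_mul_gaussianPDFReal.neg).bdd_mul hf.aestronglyMeasurable
      (Filter.Eventually.of_forall hK)
  have := integral_mul_deriv_eq_deriv_mul_of_integrable (fun x _ => hd x)
    (fun x _ => hasDerivAt_gaussianPDFReal_zero_one x) h1
    (integrable_bounded_mul_gaussianPDFReal hf' hK')
    (integrable_bounded_mul_gaussianPDFReal hf hK)
  rw [integral_gaussianReal_zero_one, integral_gaussianReal_zero_one]
  simp only [mul_neg, integral_neg, neg_inj] at this
  rw [integral_congr_ae (g := fun x => f x * (x * gaussianPDFReal 0 1 x)), this]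
  · exact integral_congr_ae (.of_forall fun x => mul_comm _ _)
  · exact .of_forall fun x => by ring

section FiniteDimensional

variable {E : Type*} [NormedAddCommGroup E] [InnerProductSpace ℝ E] [FiniteDimensional ℝ E]
  [MeasurableSpace E] [BorelSpace E]

/-- The component of a standard Gaussian vector along a unit vector `c` is independent of the
orthogonal component, and is a standard Gaussian variable. -/
theorem stdGaussian_eq_conv {c : E} (hc : ‖c‖ = 1) :
    stdGaussian E = ((gaussianReal 0 1).map fun s => s • c) ∗
      ((stdGaussian E).map fun z => z - ⟪c, z⟫ • c) := by
  have m1 : Measurable fun s : ℝ => s • c := by fun_prop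
  have m2 : Measurable fun z : E => z - ⟪c, z⟫ • c := by fun_prop
  have := Measure.isProbabilityMeasure_map (μ := gaussianReal 0 1) m1.aemeasurable
  have := Measure.isProbabilityMeasure_map (μ := stdGaussian E) m2.aemeasurable
  refine Measure.ext_of_charFun (funext fun t => ?_)
  have e1 : charFun ((gaussianReal 0 1).map fun s => s • c) t = charFun (gaussianReal 0 1) ⟪c, t⟫ := by
    rw [charFun_apply, charFun_apply, integral_map m1.aemeasurable (by fun_prop)]
    simp [real_inner_smul_left, mul_comm]
  have e2 : charFun ((stdGaussian E).map fun z => z - ⟪c, z⟫ • c) t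
      = charFun (stdGaussian E) (t - ⟪c, t⟫ • c) := by
    rw [charFun_apply, charFun_apply, integral_map m2.aemeasurable (by fun_prop)]
    simp [real_inner_smul_right, inner_sub_left, inner_sub_right, mul_comm,
      real_inner_comm]
  rw [charFun_conv, e1, e2, charFun_stdGaussian, charFun_stdGaussian, charFun_gaussianReal,
    ← Complex.exp_add]
  congr 1
  have h : ‖t - ⟪c, t⟫ • c‖ ^ 2 = ‖t‖ ^ 2 - ⟪c, t⟫ ^ 2 := by
    rw [norm_sub_sq_real, norm_smul, real_inner_smul_right, real_inner_comm, hc, mul_one,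
      Real.norm_eq_abs, sq_abs]
    ring
  rw [← Complex.ofReal_pow ‖t - _‖, h]
  push_cast
  ring

theorem integrable_inner_stdGaussian (c : E) : Integrable (fun z => ⟪c, z⟫) (stdGaussian E) :=
  IsGaussian.integrable_dual (stdGaussian E) (innerSL ℝ c)

/-- Gaussian integration by parts in the direction of a unit vector, from the one-dimensional formula
for the component along it. -/
theorem integral_inner_mul_stdGaussian_of_norm_eq_one {c : E} (hc : ‖c‖ = 1) {f f' : E → ℝ} {K : ℝ}
    (hd : ∀ z, HasDerivAt (fun s : ℝ => f (z + s • c)) (f' z) 0) (hf : Measurable f)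
    (hf' : Measurable f') (hK : ∀ z, |f z| ≤ K) (hK' : ∀ z, |f' z| ≤ K) :
    ∫ z, ⟪c, z⟫ * f z ∂stdGaussian E = ∫ z, f' z ∂stdGaussian E := by
  have m1 : Measurable fun s : ℝ => s • c := by fun_prop
  have m2 : Measurable fun z : E => z - ⟪c, z⟫ • c := by fun_prop
  have := Measure.isProbabilityMeasure_map (μ := gaussianReal 0 1) m1.aemeasurable
  have := Measure.isProbabilityMeasure_map (μ := stdGaussian E) m2.aemeasurable
  have i1 : Integrable (fun z => ⟪c, z⟫ * f z) (stdGaussian E) :=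
    (integrable_inner_stdGaussian c).mul_bdd hf.aestronglyMeasurable (.of_forall hK)
  have i2 : Integrable f' (stdGaussian E) :=
    Integrable.of_bound hf'.aestronglyMeasurable K (.of_forall hK')
  -- the integral over the component along `c` is the inner one
  have key : ∀ g : E → ℝ, Measurable g → Integrable g (stdGaussian E) → ∫ z, g z ∂stdGaussian E =
      ∫ z, ∫ s, g (s • c + (z - ⟪c, z⟫ • c)) ∂gaussianReal 0 1 ∂stdGaussian E := by
    intro g hg hi
    rw [stdGaussian_eq_conv hc] at hi
    have hp : Integrable (fun p : E × E => g (p.1 + p.2))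
        (((gaussianReal 0 1).map fun s => s • c).prod
          ((stdGaussian E).map fun z => z - ⟪c, z⟫ • c)) :=
      (integrable_map_measure hg.aestronglyMeasurable (by fun_prop)).1 hi
    conv_lhs => rw [stdGaussian_eq_conv hc]
    refine (integral_map (φ := fun p : E × E => p.1 + p.2) (by fun_prop)
      hg.aestronglyMeasurable).trans ?_
    rw [integral_prod_symm _ hp]
    rw [integral_map m2.aemeasurable]
    · congr 1
      ext z
      rw [integral_map m1.aemeasurable]
      exact (hg.comp (by fun_prop)).aestronglyMeasurable
    · exact hp.aestronglyMeasurable.prod_swap.integral_prod_right'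
  rw [key _ (by fun_prop) i1, key _ hf' i2]
  congr 1
  ext z
  have hcz : ⟪c, z - ⟪c, z⟫ • c⟫ = 0 := by
    rw [inner_sub_right, real_inner_smul_right, real_inner_self_eq_norm_sq, hc]; ring
  have hcs : ∀ s : ℝ, ⟪c, s • c + (z - ⟪c, z⟫ • c)⟫ = s := fun s => by
    rw [inner_add_right, hcz, real_inner_smul_right, real_inner_self_eq_norm_sq, hc]; ring
  simp only [hcs]
  refine integral_id_mul_gaussianReal (K := K) (fun s => ?_) (hf'.comp (by fun_prop))
    (fun _ => hK _) (fun _ => hK' _)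
  have h := hd (s • c + (z - ⟪c, z⟫ • c))
  have h2 := HasDerivAt.comp_sub_const s s (by simpa using h)
  refine h2.congr_of_eventuallyEq (.of_forall fun r => ?_)
  simp only
  congr 1
  module

/-- Gaussian integration by parts: `E[⟪c, Z⟫ f(Z)] = E[∂_c f(Z)]` for a standard Gaussian vector `Z`
and a bounded function `f` whose derivative `f'` in direction `c` is bounded. -/
theorem integral_inner_mul_stdGaussian (c : E) {f f' : E → ℝ} {K : ℝ}
    (hd : ∀ z, HasDerivAt (fun s : ℝ => f (z + s • c)) (f' z) 0) (hf : Measurable f)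
    (hf' : Measurable f') (hK : ∀ z, |f z| ≤ K) (hK' : ∀ z, |f' z| ≤ K) :
    ∫ z, ⟪c, z⟫ * f z ∂stdGaussian E = ∫ z, f' z ∂stdGaussian E := by
  rcases eq_or_ne c 0 with rfl | h0
  · have : f' = 0 := funext fun z => by
      simpa using (hd z).unique (by simpa using hasDerivAt_const (0 : ℝ) (f z))
    simp [this]
  have hn : 0 < ‖c‖ := norm_pos_iff.2 h0
  have hu : ‖(‖c‖⁻¹ • c)‖ = 1 := by simp [norm_smul, hn.ne']
  have h := integral_inner_mul_stdGaussian_of_norm_eq_one hu (f := f) (f' := fun z => ‖c‖⁻¹ * f' z)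
    (K := max K (‖c‖⁻¹ * K)) (fun z => ?_) hf (by fun_prop) (fun z => (hK z).trans (le_max_left _ _))
    (fun z => ?_)
  · simp only [real_inner_smul_left, mul_assoc, integral_const_mul] at h
    exact mul_left_cancel₀ (inv_ne_zero hn.ne') h
  · have h1 : HasDerivAt (fun s : ℝ => s * ‖c‖⁻¹) ‖c‖⁻¹ 0 := by
      simpa using (hasDerivAt_id (0 : ℝ)).mul_const ‖c‖⁻¹
    have h2 := HasDerivAt.comp (0 : ℝ) (by simpa using hd z) h1
    rw [mul_comm]
    refine h2.congr_of_eventuallyEq (.of_forall fun r => ?_)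
    simp [smul_smul]
  · rw [abs_mul, abs_of_pos (inv_pos.2 hn)]
    exact (mul_le_mul_of_nonneg_left (hK' z) (inv_pos.2 hn).le).trans (le_max_right _ _)

end FiniteDimensional

/-! ### The log-sum-exp function -/

section LogSumExp

variable {ι : Type*} [Fintype ι]

/-- The log-sum-exp function `x ↦ log ∑ᵢ exp xᵢ`, a smooth approximation of the maximum. -/
noncomputable def logSumExp (x : ι → ℝ) : ℝ := Real.log (∑ i, Real.exp (x i))

/-- The gradient of `logSumExp`: the probability weights proportional to `exp xᵢ`. -/
noncomputable def softmax (x : ι → ℝ) (i : ι) : ℝ := Real.exp (x i) / ∑ j, Real.exp (x j)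

theorem softmax_nonneg (x : ι → ℝ) (i : ι) : 0 ≤ softmax x i := by
  unfold softmax; positivity

theorem measurable_logSumExp : Measurable (logSumExp : (ι → ℝ) → ℝ) := by
  unfold logSumExp; fun_prop

theorem measurable_softmax (i : ι) : Measurable fun x : ι → ℝ => softmax x i := by
  unfold softmax; fun_prop

theorem hasDerivAt_sum_exp {x : ℝ → ι → ℝ} {x' : ι → ℝ} {s : ℝ}
    (hx : ∀ i, HasDerivAt (fun r => x r i) (x' i) s) :
    HasDerivAt (fun r => ∑ i, Real.exp (x r i)) (∑ i, Real.exp (x s i) * x' i) s :=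
  HasDerivAt.fun_sum fun i _ => (hx i).exp

variable [Nonempty ι]

theorem sum_exp_pos (x : ι → ℝ) : 0 < ∑ i, Real.exp (x i) :=
  Finset.sum_pos (fun _ _ => Real.exp_pos _) Finset.univ_nonempty

theorem sum_softmax (x : ι → ℝ) : ∑ i, softmax x i = 1 := by
  simp only [softmax, ← Finset.sum_div]
  exact div_self (sum_exp_pos x).ne'

theorem softmax_le_one (x : ι → ℝ) (i : ι) : softmax x i ≤ 1 := by
  rw [← sum_softmax x]
  exact Finset.single_le_sum (fun j _ => softmax_nonneg x j) (Finset.mem_univ i)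

theorem abs_softmax_le_one (x : ι → ℝ) (i : ι) : |softmax x i| ≤ 1 := by
  rw [abs_of_nonneg (softmax_nonneg x i)]; exact softmax_le_one x i

theorem abs_sum_softmax_mul_le (x y : ι → ℝ) : |∑ i, softmax x i * y i| ≤ ∑ i, |y i| := by
  refine (Finset.abs_sum_le_sum_abs _ _).trans (Finset.sum_le_sum fun i _ => ?_)
  rw [abs_mul]
  exact mul_le_of_le_one_left (abs_nonneg _) (abs_softmax_le_one x i)

theorem hasDerivAt_logSumExp {x : ℝ → ι → ℝ} {x' : ι → ℝ} {s : ℝ}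
    (hx : ∀ i, HasDerivAt (fun r => x r i) (x' i) s) :
    HasDerivAt (fun r => logSumExp (x r)) (∑ i, softmax (x s) i * x' i) s := by
  refine ((hasDerivAt_sum_exp hx).log (sum_exp_pos _).ne').congr_deriv ?_
  simp only [softmax, Finset.sum_div, div_mul_eq_mul_div]

theorem hasDerivAt_softmax {x : ℝ → ι → ℝ} {x' : ι → ℝ} {s : ℝ}
    (hx : ∀ i, HasDerivAt (fun r => x r i) (x' i) s) (i : ι) :
    HasDerivAt (fun r => softmax (x r) i)
      (softmax (x s) i * (x' i - ∑ j, softmax (x s) j * x' j)) s := by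
  have h0 := (sum_exp_pos (x s)).ne'
  refine ((hx i).exp.div (hasDerivAt_sum_exp hx) h0).congr_deriv ?_
  simp only [softmax, div_mul_eq_mul_div, ← Finset.sum_div]
  field_simp

theorem le_logSumExp (x : ι → ℝ) (i : ι) : x i ≤ logSumExp x := by
  rw [logSumExp, Real.le_log_iff_exp_le (sum_exp_pos x)]
  exact Finset.single_le_sum (f := fun j => Real.exp (x j)) (fun j _ => (Real.exp_pos _).le)
    (Finset.mem_univ i)

theorem logSumExp_le {x : ι → ℝ} {m : ℝ} (h : ∀ i, x i ≤ m) :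
    logSumExp x ≤ m + Real.log (Fintype.card ι) := by
  have hc : (0 : ℝ) < Fintype.card ι := by exact_mod_cast Fintype.card_pos
  rw [logSumExp, Real.log_le_iff_le_exp (sum_exp_pos x), Real.exp_add, Real.exp_log hc]
  calc ∑ i, Real.exp (x i) ≤ ∑ _i : ι, Real.exp m :=
        Finset.sum_le_sum fun i _ => Real.exp_le_exp.2 (h i)
    _ = Real.exp m * Fintype.card ι := by simp [mul_comm]

theorem abs_logSumExp_le (x : ι → ℝ) :
    |logSumExp x| ≤ ∑ i, |x i| + Real.log (Fintype.card ι) := by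
  have hs : ∀ i, |x i| ≤ ∑ j, |x j| := fun i =>
    Finset.single_le_sum (f := fun j => |x j|) (fun j _ => abs_nonneg _) (Finset.mem_univ i)
  have hl : 0 ≤ Real.log (Fintype.card ι) := Real.log_natCast_nonneg _
  obtain ⟨i⟩ := ‹Nonempty ι›
  have : Nonempty ι := ⟨i⟩
  refine abs_le.2 ⟨?_, logSumExp_le fun i => (le_abs_self _).trans (hs i)⟩
  linarith [le_logSumExp x i, neg_abs_le (x i), hs i]

/-- The pairing of the Hessian of `logSumExp` with the matrix `D` depends only on the increments
`Dᵢᵢ + Dⱼⱼ - 2 Dᵢⱼ`, and with nonnegative weights. -/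
theorem sum_softmax_mul_sub_nonneg (x : ι → ℝ) {D : ι → ι → ℝ}
    (hD : ∀ i j, 2 * D i j ≤ D i i + D j j) :
    0 ≤ ∑ i, softmax x i * (D i i - ∑ j, softmax x j * D i j) := by
  set p := softmax x
  have h1 : ∑ i, p i * (D i i - ∑ j, p j * D i j)
      = ∑ i, p i * D i i - ∑ i, ∑ j, p i * p j * D i j := by
    simp only [mul_sub, Finset.sum_sub_distrib, Finset.mul_sum, mul_assoc]
  have h2 : ∑ i, ∑ j, p i * p j * D i i = ∑ i, p i * D i i := by
    refine Finset.sum_congr rfl fun i _ => ?_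
    rw [← Finset.sum_mul, ← Finset.mul_sum, sum_softmax, mul_one]
  have h3 : ∑ i, ∑ j, p i * p j * D j j = ∑ i, p i * D i i := by
    rw [Finset.sum_comm, ← h2]
    simp only [mul_comm (p _) (p _)]
  have h4 : 0 ≤ ∑ i, ∑ j, p i * p j * (D i i + D j j - 2 * D i j) :=
    Finset.sum_nonneg fun i _ => Finset.sum_nonneg fun j _ => mul_nonneg
      (mul_nonneg (softmax_nonneg x i) (softmax_nonneg x j)) (sub_nonneg.2 (hD i j))
  have h5 : ∑ i, ∑ j, p i * p j * (D i i + D j j - 2 * D i j)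
      = ∑ i, ∑ j, p i * p j * D i i + ∑ i, ∑ j, p i * p j * D j j
        - 2 * ∑ i, ∑ j, p i * p j * D i j := by
    simp only [Finset.mul_sum, ← Finset.sum_add_distrib, ← Finset.sum_sub_distrib]
    refine Finset.sum_congr rfl fun i _ => Finset.sum_congr rfl fun j _ => ?_
    ring
  rw [h5, h2, h3] at h4
  rw [h1]; linarith

end LogSumExp

/-! ### Gaussian interpolation -/

section Interpolation

variable {ι : Type*} [Fintype ι] [Nonempty ι]
variable {E : Type*} [NormedAddCommGroup E] [InnerProductSpace ℝ E] [FiniteDimensional ℝ E]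
  [MeasurableSpace E] [BorelSpace E]

theorem integrable_norm_stdGaussian : Integrable (fun z : E => ‖z‖) (stdGaussian E) :=
  (IsGaussian.integrable_id (μ := stdGaussian E)).norm

theorem integrable_logSumExp_stdGaussian (a : ι → E) :
    Integrable (fun z => logSumExp fun i => ⟪a i, z⟫) (stdGaussian E) := by
  refine Integrable.mono' (g := fun z => ∑ i, |⟪a i, z⟫| + Real.log (Fintype.card ι)) ?_
    (measurable_logSumExp.comp (by fun_prop)).aestronglyMeasurable
    (.of_forall fun z => abs_logSumExp_le _)
  exact (integrable_finsetSum _ fun i _ => (integrable_inner_stdGaussian (a i)).abs).add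
    (integrable_const _)

/-- The left-hand side is the derivative of `E[logSumExp ⟪dᵢ, Z⟫]` as each `dᵢ` moves in the
direction `cᵢ`. Integration by parts turns it into the pairing of the Hessian of `logSumExp` with `⟪cᵢ, dⱼ⟫`. -/
theorem integral_softmax_mul_inner (d c : ι → E) :
    ∫ z, ∑ i, softmax (fun j => ⟪d j, z⟫) i * ⟪c i, z⟫ ∂stdGaussian E =
      ∫ z, ∑ i, softmax (fun j => ⟪d j, z⟫) i *
        (⟪c i, d i⟫ - ∑ j, softmax (fun k => ⟪d k, z⟫) j * ⟪c i, d j⟫) ∂stdGaussian E := by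
  have hm : ∀ i, Measurable fun z : E => softmax (fun j => ⟪d j, z⟫) i := fun i =>
    (measurable_softmax i).comp (f := fun z i => ⟪d i, z⟫) (by fun_prop)
  have hb : ∀ i, ∀ z : E, |softmax (fun j => ⟪d j, z⟫) i *
      (⟪c i, d i⟫ - ∑ j, softmax (fun k => ⟪d k, z⟫) j * ⟪c i, d j⟫)| ≤
      |⟪c i, d i⟫| + ∑ j, |⟪c i, d j⟫| := fun i z => by
    rw [abs_mul]
    exact (mul_le_of_le_one_left (abs_nonneg _) (abs_softmax_le_one _ i)).trans
      ((abs_sub _ _).trans (add_le_add le_rfl (abs_sum_softmax_mul_le _ _)))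
  have hm' : ∀ i, Measurable fun z : E => softmax (fun j => ⟪d j, z⟫) i *
      (⟪c i, d i⟫ - ∑ j, softmax (fun k => ⟪d k, z⟫) j * ⟪c i, d j⟫) := fun i => by fun_prop
  rw [integral_finsetSum, integral_finsetSum]
  · refine Finset.sum_congr rfl fun i _ => ?_
    rw [← integral_inner_mul_stdGaussian (c i) (f := fun z => softmax (fun j => ⟪d j, z⟫) i)
      (K := max 1 (|⟪c i, d i⟫| + ∑ j, |⟪c i, d j⟫|)) _ (hm i) (hm' i)
      (fun z => (abs_softmax_le_one _ i).trans (le_max_left _ _))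
      (fun z => (hb i z).trans (le_max_right _ _))]
    · simp only [mul_comm]
    · intro z
      have h := hasDerivAt_softmax (x := fun s j => ⟪d j, z + s • c i⟫)
        (x' := fun j => ⟪c i, d j⟫) (s := 0) (fun j => ?_) i
      · simpa using h
      · simp only [inner_add_right, real_inner_smul_right]
        simpa [real_inner_comm] using
          ((hasDerivAt_id (0 : ℝ)).mul_const ⟪d j, c i⟫).const_add ⟪d j, z⟫
  · exact fun i _ => Integrable.of_bound (hm' i).aestronglyMeasurable _ (.of_forall (hb i))
  · exact fun i _ => (integrable_inner_stdGaussian (c i)).bdd_mul (hm i).aestronglyMeasurable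
      (.of_forall fun z => abs_softmax_le_one _ i)

theorem hasDerivAt_integral_logSumExp (a b : ι → E) (θ : ℝ) :
    HasDerivAt (fun t => ∫ z, logSumExp (fun i => ⟪Real.cos t • a i + Real.sin t • b i, z⟫)
        ∂stdGaussian E)
      (∫ z, ∑ i, softmax (fun j => ⟪Real.cos θ • a j + Real.sin θ • b j, z⟫) i *
        ⟪-Real.sin θ • a i + Real.cos θ • b i, z⟫ ∂stdGaussian E) θ := by
  refine (hasDerivAt_integral_of_dominated_loc_of_deriv_le (s := Set.univ)
    (F' := fun t z => ∑ i, softmax (fun j => ⟪Real.cos t • a j + Real.sin t • b j, z⟫) i *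
        ⟪-Real.sin t • a i + Real.cos t • b i, z⟫)
    (bound := fun z => ∑ i, (‖a i‖ + ‖b i‖) * ‖z‖) Filter.univ_mem (.of_forall fun t => ?_)
    (integrable_logSumExp_stdGaussian _) ?_ (.of_forall fun z t _ => ?_) ?_
    (.of_forall fun z t _ => ?_)).2
  · exact (integrable_logSumExp_stdGaussian _).aestronglyMeasurable
  · refine (Finset.measurable_sum _ fun i _ => Measurable.mul ?_ (by fun_prop)).aestronglyMeasurable
    exact (measurable_softmax i).comp
      (f := fun z j => ⟪Real.cos θ • a j + Real.sin θ • b j, z⟫) (by fun_prop)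
  · refine (abs_sum_softmax_mul_le _ _).trans (Finset.sum_le_sum fun i _ => ?_)
    refine (abs_real_inner_le_norm _ _).trans (mul_le_mul_of_nonneg_right ?_ (norm_nonneg _))
    refine (norm_add_le _ _).trans (add_le_add ?_ ?_)
    · rw [norm_smul, norm_neg]
      exact mul_le_of_le_one_left (norm_nonneg _) (Real.abs_sin_le_one t)
    · rw [norm_smul]
      exact mul_le_of_le_one_left (norm_nonneg _) (Real.abs_cos_le_one t)
  · exact integrable_finsetSum _ fun i _ => integrable_norm_stdGaussian.const_mul _
  · refine hasDerivAt_logSumExp fun i => ?_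
    simp only [inner_add_left, real_inner_smul_left]
    exact ((Real.hasDerivAt_cos t).mul_const _).add ((Real.hasDerivAt_sin t).mul_const _)

/-- The interpolation behind the Sudakov–Fernique inequality: along
`θ ↦ cos θ aᵢ + sin θ bᵢ` the expectation of `logSumExp` increases. -/
theorem integral_logSumExp_le_of_orthogonal {a b : ι → E} (hab : ∀ i j, ⟪a i, b j⟫ = 0)
    (h : ∀ i j, ‖a i - a j‖ ≤ ‖b i - b j‖) :
    ∫ z, logSumExp (fun i => ⟪a i, z⟫) ∂stdGaussian E ≤
      ∫ z, logSumExp (fun i => ⟪b i, z⟫) ∂stdGaussian E := by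
  have hd := hasDerivAt_integral_logSumExp a b
  have hmono := monotoneOn_of_deriv_nonneg (convex_Icc (0 : ℝ) (Real.pi / 2))
    (fun t _ => (hd t).continuousAt.continuousWithinAt)
    (fun t _ => (hd t).differentiableAt.differentiableWithinAt) ?_
  · have h0 := hmono (Set.left_mem_Icc.2 Real.pi_div_two_pos.le)
      (Set.right_mem_Icc.2 Real.pi_div_two_pos.le) Real.pi_div_two_pos.le
    simpa using h0
  · intro t ht
    rw [interior_Icc] at ht
    rw [(hd t).deriv, integral_softmax_mul_inner (fun i => Real.cos t • a i + Real.sin t • b i)]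
    have hin : ∀ i j, ⟪-Real.sin t • a i + Real.cos t • b i, Real.cos t • a j + Real.sin t • b j⟫
        = Real.sin t * Real.cos t * (⟪b i, b j⟫ - ⟪a i, a j⟫) := fun i j => by
      have := hab i j
      have h2 : ⟪b i, a j⟫ = 0 := by rw [real_inner_comm]; exact hab j i
      simp only [inner_add_left, inner_add_right, real_inner_smul_left, real_inner_smul_right, this,
        h2]
      ring
    refine integral_nonneg fun z => ?_
    refine sum_softmax_mul_sub_nonneg _
      (D := fun i j => ⟪-Real.sin t • a i + Real.cos t • b i, Real.cos t • a j + Real.sin t • b j⟫)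
      fun i j => ?_
    simp only [hin]
    have hs : 0 ≤ Real.sin t * Real.cos t := mul_nonneg
      (Real.sin_nonneg_of_nonneg_of_le_pi ht.1.le (by linarith [ht.2, Real.pi_pos]))
      (Real.cos_nonneg_of_mem_Icc ⟨by linarith [ht.1, Real.pi_pos], ht.2.le⟩)
    have hn := pow_le_pow_left₀ (norm_nonneg _) (h i j) 2
    rw [norm_sub_sq_real, norm_sub_sq_real] at hn
    simp only [real_inner_self_eq_norm_sq]
    nlinarith

end Interpolation

/-! ### Gaussian families and the Sudakov–Fernique inequality -/

section GaussianVector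

variable {ι : Type*} [Fintype ι]
variable {E : Type*} [NormedAddCommGroup E] [InnerProductSpace ℝ E] [FiniteDimensional ℝ E]
  [MeasurableSpace E] [BorelSpace E]
variable {F : Type*} [NormedAddCommGroup F] [InnerProductSpace ℝ F] [FiniteDimensional ℝ F]
  [MeasurableSpace F] [BorelSpace F]

/-- A centered Gaussian vector is the image of a standard one as soon as the variances of its linear
combinations agree. The hypothesis is on characteristic functions at `1` only, because `t` may be
scaled. -/
theorem map_eq_map_stdGaussian {Ω : Type*} [MeasurableSpace Ω] {P : Measure Ω}
    [IsProbabilityMeasure P] {X : Ω → ι → ℝ} (hX : AEMeasurable X P) (a : ι → E)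
    (h : ∀ t : ι → ℝ, charFun (P.map fun ω => ∑ i, t i * X ω i) 1
      = Complex.exp (-‖∑ i, t i • a i‖ ^ 2 / 2)) :
    P.map X = (stdGaussian E).map fun z i => ⟪a i, z⟫ := by
  classical
  have m2 : Measurable fun (z : E) i => ⟪a i, z⟫ := by fun_prop
  have := Measure.isProbabilityMeasure_map (μ := P) hX
  have := Measure.isProbabilityMeasure_map (μ := stdGaussian E) m2.aemeasurable
  refine Measure.ext_of_charFunDual (funext fun L => ?_)
  have hL : ∀ x : ι → ℝ, L x = ∑ i, L (Pi.single i 1) * x i := fun x => by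
    conv_lhs => rw [pi_eq_sum_univ' x, map_sum]
    refine Finset.sum_congr rfl fun i _ => ?_
    rw [map_smul, smul_eq_mul, mul_comm]
  have hl := h fun i => L (Pi.single i 1)
  rw [charFunDual_eq_charFun_map_one, AEMeasurable.map_map_of_aemeasurable
    L.continuous.aemeasurable hX]
  have e : ⇑L ∘ X = fun ω => ∑ i, L (Pi.single i 1) * X ω i := funext fun ω => hL _
  rw [e, hl, charFunDual_eq_charFun_map_one, Measure.map_map L.continuous.measurable m2,
    ← charFun_stdGaussian, charFun_apply, charFun_apply, integral_map (by fun_prop) (by fun_prop)]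
  refine integral_congr_ae (.of_forall fun z => ?_)
  simp only [Function.comp_apply]
  rw [hL]
  simp only [inner_sum, real_inner_smul_right, real_inner_comm (a _) z]
  simp

theorem charFun_map_sum_stdGaussian (a : ι → E) (t : ι → ℝ) :
    charFun ((stdGaussian E).map fun z => ∑ i, t i * ⟪a i, z⟫) 1
      = Complex.exp (-‖∑ i, t i • a i‖ ^ 2 / 2) := by
  rw [← charFun_stdGaussian, charFun_apply, charFun_apply, integral_map (by fun_prop) (by fun_prop)]
  refine integral_congr_ae (.of_forall fun z => ?_)
  simp only [inner_sum, real_inner_smul_right, real_inner_comm (a _) z]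
  simp

/-- The law of `(⟪aᵢ, Z⟫)ᵢ` depends only on the Gram matrix of `a`. -/
theorem map_stdGaussian_eq_of_inner_eq {a : ι → E} {b : ι → F}
    (h : ∀ i j, ⟪a i, a j⟫ = ⟪b i, b j⟫) :
    ((stdGaussian E).map fun z i => ⟪a i, z⟫) = (stdGaussian F).map fun z i => ⟪b i, z⟫ := by
  refine map_eq_map_stdGaussian (by fun_prop) b fun t => ?_
  rw [charFun_map_sum_stdGaussian]
  have : ‖∑ i, t i • a i‖ ^ 2 = ‖∑ i, t i • b i‖ ^ 2 := by
    simp only [← real_inner_self_eq_norm_sq, sum_inner, inner_sum, real_inner_smul_left,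
      real_inner_smul_right, h]
  rw [← Complex.ofReal_pow, this, Complex.ofReal_pow]

theorem integral_comp_inner_stdGaussian_eq {a : ι → E} {b : ι → F}
    (h : ∀ i j, ⟪a i, a j⟫ = ⟪b i, b j⟫) {f : (ι → ℝ) → ℝ} (hf : Measurable f) :
    ∫ z, f (fun i => ⟪a i, z⟫) ∂stdGaussian E = ∫ z, f (fun i => ⟪b i, z⟫) ∂stdGaussian F := by
  have := congrArg (fun μ => ∫ x, f x ∂μ) (map_stdGaussian_eq_of_inner_eq h)
  simpa only [integral_map (Measurable.aemeasurable (by fun_prop : Measurable fun (z : E) i =>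
    ⟪a i, z⟫)) hf.aestronglyMeasurable, integral_map (Measurable.aemeasurable
    (by fun_prop : Measurable fun (z : F) i => ⟪b i, z⟫)) hf.aestronglyMeasurable] using this

/-- The comparison of `integral_logSumExp_le_of_orthogonal` without orthogonality: only the Gram
matrix of each family matters, so the two families may be moved to orthogonal spaces. -/
theorem integral_logSumExp_le [Nonempty ι] {a : ι → E} {b : ι → F}
    (h : ∀ i j, ‖a i - a j‖ ≤ ‖b i - b j‖) :
    ∫ z, logSumExp (fun i => ⟪a i, z⟫) ∂stdGaussian E ≤
      ∫ z, logSumExp (fun i => ⟪b i, z⟫) ∂stdGaussian F := by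
  have key := integral_logSumExp_le_of_orthogonal (a := fun i => WithLp.toLp 2 (a i, (0 : F)))
    (b := fun i => WithLp.toLp 2 ((0 : E), b i)) (fun i j => by simp) (fun i j => by
      rw [← WithLp.toLp_sub, ← WithLp.toLp_sub, WithLp.prod_norm_eq_of_L2, WithLp.prod_norm_eq_of_L2]
      simpa using h i j)
  have ea := integral_comp_inner_stdGaussian_eq (a := fun i => WithLp.toLp 2 (a i, (0 : F)))
    (b := a) (fun i j => by simp) measurable_logSumExp
  have eb := integral_comp_inner_stdGaussian_eq (a := fun i => WithLp.toLp 2 ((0 : E), b i))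
    (b := b) (fun i j => by simp) measurable_logSumExp
  rwa [ea, eb] at key

theorem integrable_iSup_of_integrable [Nonempty ι] {Ω : Type*} [MeasurableSpace Ω] {P : Measure Ω}
    {X : ι → Ω → ℝ} (hX : ∀ i, Integrable (X i) P) : Integrable (fun ω => ⨆ i, X i ω) P := by
  refine Integrable.mono' (g := fun ω => ∑ i, |X i ω|)
    (integrable_finsetSum _ fun i _ => (hX i).abs)
    (AEMeasurable.iSup fun i => (hX i).aemeasurable).aestronglyMeasurable (.of_forall fun ω => ?_)
  have hs : ∀ i, |X i ω| ≤ ∑ j, |X j ω| := fun i =>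
    Finset.single_le_sum (f := fun j => |X j ω|) (fun j _ => abs_nonneg _) (Finset.mem_univ i)
  obtain ⟨i⟩ := ‹Nonempty ι›
  have : Nonempty ι := ⟨i⟩
  refine abs_le.2 ⟨?_, ciSup_le fun i => (le_abs_self _).trans (hs i)⟩
  linarith [le_ciSup (Set.finite_range fun i => X i ω).bddAbove i, neg_abs_le (X i ω), hs i]

/-- The **Sudakov–Fernique inequality**, for the Gaussian families `⟪aᵢ, Z⟫` and `⟪bᵢ, W⟫`. -/
theorem sudakov_fernique [Nonempty ι] {a : ι → E} {b : ι → F}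
    (h : ∀ i j, ‖a i - a j‖ ≤ ‖b i - b j‖) :
    ∫ z, ⨆ i, ⟪a i, z⟫ ∂stdGaussian E ≤ ∫ z, ⨆ i, ⟪b i, z⟫ ∂stdGaussian F := by
  have bdd : ∀ x : ι → ℝ, BddAbove (Set.range x) := fun x => (Set.finite_range x).bddAbove
  have ia := integrable_iSup_of_integrable fun i => integrable_inner_stdGaussian (a i)
  have ib := integrable_iSup_of_integrable fun i => integrable_inner_stdGaussian (b i)
  -- the error of `logSumExp` does not grow under scaling, and is negligible as `r → ∞`
  have hr : ∀ r : ℝ, 0 < r → r * ∫ z, ⨆ i, ⟪a i, z⟫ ∂stdGaussian E ≤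
      r * (∫ z, ⨆ i, ⟪b i, z⟫ ∂stdGaussian F) + Real.log (Fintype.card ι) := by
    intro r hr
    calc r * ∫ z, ⨆ i, ⟪a i, z⟫ ∂stdGaussian E
        = ∫ z, r * ⨆ i, ⟪a i, z⟫ ∂stdGaussian E := (integral_const_mul _ _).symm
      _ ≤ ∫ z, logSumExp (fun i => ⟪r • a i, z⟫) ∂stdGaussian E := by
          refine integral_mono (ia.const_mul r) (integrable_logSumExp_stdGaussian _) fun z => ?_
          rw [← le_div_iff₀' hr]
          refine ciSup_le fun i => ?_
          rw [le_div_iff₀' hr, ← real_inner_smul_left]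
          exact le_logSumExp (fun i => ⟪r • a i, z⟫) i
      _ ≤ ∫ z, logSumExp (fun i => ⟪r • b i, z⟫) ∂stdGaussian F :=
          integral_logSumExp_le fun i j => by
            rw [← smul_sub, ← smul_sub, norm_smul, norm_smul]
            exact mul_le_mul_of_nonneg_left (h i j) (norm_nonneg _)
      _ ≤ ∫ z, (r * ⨆ i, ⟪b i, z⟫) + Real.log (Fintype.card ι) ∂stdGaussian F := by
          refine integral_mono (integrable_logSumExp_stdGaussian _)
            ((ib.const_mul r).add (integrable_const _)) fun z => logSumExp_le fun i => ?_
          rw [real_inner_smul_left]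
          exact mul_le_mul_of_nonneg_left (le_ciSup (bdd fun i => ⟪b i, z⟫) i) hr.le
      _ = _ := by
          rw [integral_add (ib.const_mul r) (integrable_const _), integral_const_mul]
          simp
  refine le_of_forall_pos_le_add fun ε hε => ?_
  have hl : 0 ≤ Real.log (Fintype.card ι) := Real.log_natCast_nonneg _
  have h1 := hr ((Real.log (Fintype.card ι) + 1) / ε) (by positivity)
  have h2 : (Real.log (Fintype.card ι) + 1) / ε * ε = Real.log (Fintype.card ι) + 1 := by
    field_simp
  refine le_of_mul_le_mul_left (a := (Real.log (Fintype.card ι) + 1) / ε) ?_ (by positivity)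
  rw [mul_add, h2]
  linarith

/-- Adding an independent centered Gaussian family does not decrease the expected maximum. -/
theorem integral_iSup_inner_le_prod [Nonempty ι] (a : ι → E) (c : ι → F) :
    ∫ z, ⨆ i, ⟪a i, z⟫ ∂stdGaussian E ≤
      ∫ z, ⨆ i, ⟪WithLp.toLp 2 (a i, c i), z⟫ ∂stdGaussian (WithLp 2 (E × F)) := by
  have bdd : ∀ x : ι → ℝ, BddAbove (Set.range x) := fun x => (Set.finite_range x).bddAbove
  have hm : Measurable fun x : ι → ℝ => ⨆ i, x i := Measurable.iSup fun i => measurable_pi_apply i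
  have e0 : ∫ z, ⨆ i, ⟪WithLp.toLp 2 (a i, (0 : F)), z⟫ ∂stdGaussian (WithLp 2 (E × F)) =
      ∫ z, ⨆ i, ⟪a i, z⟫ ∂stdGaussian E :=
    integral_comp_inner_stdGaussian_eq (fun i j => by simp) hm
  -- replacing `c` by `-c` does not change the law; `a` is the average of the two families
  have e1 : ∫ z, ⨆ i, ⟪WithLp.toLp 2 (a i, -c i), z⟫ ∂stdGaussian (WithLp 2 (E × F)) =
      ∫ z, ⨆ i, ⟪WithLp.toLp 2 (a i, c i), z⟫ ∂stdGaussian (WithLp 2 (E × F)) :=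
    integral_comp_inner_stdGaussian_eq (fun i j => by simp) hm
  have i1 := integrable_iSup_of_integrable fun i =>
    integrable_inner_stdGaussian (WithLp.toLp 2 (a i, c i))
  have i2 := integrable_iSup_of_integrable fun i =>
    integrable_inner_stdGaussian (WithLp.toLp 2 (a i, -c i))
  have i0 := integrable_iSup_of_integrable fun i =>
    integrable_inner_stdGaussian (WithLp.toLp 2 (a i, (0 : F)))
  have h := integral_mono (i0.const_mul 2) (i1.add i2) fun z => ?_
  · rw [integral_const_mul, integral_add' i1 i2, e0, e1] at h
    linarith
  · simp only [Pi.add_apply]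
    rw [← le_div_iff₀' two_pos]
    refine ciSup_le fun i => ?_
    rw [le_div_iff₀' two_pos]
    refine le_trans (le_of_eq ?_) (add_le_add (le_ciSup (bdd _) i) (le_ciSup (bdd _) i))
    simp only [WithLp.prod_inner_apply, inner_neg_left, inner_zero_left]
    ring

end GaussianVector

/-! ### The sequence space `ℓ²` -/

section Ell2

theorem inner_unitVec (j : ℕ) (x : Ell2) : ⟪unitVec j, x⟫ = x j := by
  rw [unitVec, lp.inner_single_left]; simp

theorem hasSum_inner_unitVec_sq (x : Ell2) : HasSum (fun j => ⟪unitVec j, x⟫ ^ 2) (‖x‖ ^ 2) := by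
  simpa [inner_unitVec, real_inner_self_eq_norm_sq, sq_abs] using lp.hasSum_inner (𝕜 := ℝ) x x

instance instSeparableSpaceEll2 : TopologicalSpace.SeparableSpace Ell2 := by
  have hs : TopologicalSpace.IsSeparable (Submodule.span ℝ (Set.range unitVec) : Set Ell2) :=
    (Set.countable_range unitVec).isSeparable.span
  refine TopologicalSpace.isSeparable_univ_iff.1 (hs.closure.mono fun x _ => ?_)
  have hx := lp.hasSum_single (p := 2) (by simp) x
  refine mem_closure_of_tendsto hx (.of_forall fun s => Submodule.sum_mem _ fun i _ => ?_)
  have : lp.single 2 i (x i) = x i • unitVec i := by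
    rw [unitVec, ← lp.single_smul]; simp
  rw [this]
  exact Submodule.smul_mem _ _ (Submodule.subset_span ⟨i, rfl⟩)

end Ell2

/-! ### The mean norm of a Gaussian series -/

section GaussianNorm

variable {F : Type*} [NormedAddCommGroup F] [InnerProductSpace ℝ F] [FiniteDimensional ℝ F]
  [MeasurableSpace F] [BorelSpace F]

theorem memLp_inner_stdGaussian (c : F) : MemLp (fun z => ⟪c, z⟫) 2 (stdGaussian F) :=
  IsGaussian.memLp_dual (stdGaussian F) (innerSL ℝ c) 2 (by simp)

theorem integral_inner_sq_stdGaussian (c : F) : ∫ z, ⟪c, z⟫ ^ 2 ∂stdGaussian F = ‖c‖ ^ 2 := by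
  have h := variance_dual_stdGaussian (E := F) (innerSL ℝ c)
  rw [variance_of_integral_eq_zero (innerSL ℝ c).continuous.aemeasurable
    (integral_strongDual_stdGaussian _), innerSL_apply_norm] at h
  simpa using h

theorem integrable_norm_continuousLinearMap_stdGaussian {H : Type*} [NormedAddCommGroup H]
    [NormedSpace ℝ H] (B : F →L[ℝ] H) : Integrable (fun z => ‖B z‖) (stdGaussian F) :=
  (B.integrable_comp (IsGaussian.integrable_id (μ := stdGaussian F))).norm

/-- If `Z` is a standard Gaussian vector, then `E‖A* Z‖ ≤ (E‖A* Z‖²)^{1/2} = ‖A‖_HS`. -/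
theorem integral_norm_adjoint_le (A : Ell2 →L[ℝ] F) (hA : IsHilbertSchmidt A) :
    ∫ z, ‖A.adjoint z‖ ∂stdGaussian F ≤ hsNorm A := by
  have hL : MemLp (fun z => ‖A.adjoint z‖) 2 (stdGaussian F) :=
    (A.adjoint.comp_memLp' (IsGaussian.memLp_two_id (μ := stdGaussian F))).norm
  have hi : ∀ j, Integrable (fun z => ⟪A (unitVec j), z⟫ ^ 2) (stdGaussian F) := fun j =>
    (memLp_inner_stdGaussian _).integrable_sq
  have hn : ∀ j, ∫ z, ‖⟪A (unitVec j), z⟫ ^ 2‖ ∂stdGaussian F = ‖A (unitVec j)‖ ^ 2 := fun j => by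
    simp only [Real.norm_eq_abs, abs_pow, sq_abs, integral_inner_sq_stdGaussian]
  have hsum := hasSum_integral_of_summable_integral_norm hi (by simp only [hn]; exact hA)
  simp only [integral_inner_sq_stdGaussian] at hsum
  have hsq : ∫ z, ‖A.adjoint z‖ ^ 2 ∂stdGaussian F = ∑' j, ‖A (unitVec j)‖ ^ 2 := by
    rw [hsum.tsum_eq]
    refine integral_congr_ae (.of_forall fun z => ?_)
    simp only
    rw [← (hasSum_inner_unitVec_sq _).tsum_eq]
    simp only [ContinuousLinearMap.adjoint_inner_right]
  have hv := variance_nonneg (fun z => ‖A.adjoint z‖) (stdGaussian F)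
  -- nonnegativity of the variance is the Cauchy–Schwarz inequality `(E‖A* Z‖)² ≤ E‖A* Z‖²`
  rw [variance_eq_sub hL] at hv
  refine Real.le_sqrt_of_sq_le ?_
  rw [← hsq]
  simpa using hv

end GaussianNorm

/-! ### Comparison of bilinear and linear Gaussian processes -/

section BilinearProcess

variable {ι : Type*} [Fintype ι] [Nonempty ι] {n : ℕ}
variable {U : Type*} [NormedAddCommGroup U] [InnerProductSpace ℝ U]

/-- The tensor `v ⊗ u`, as the `n`-tuple of vectors `vₘ u`. -/
noncomputable def tensorVec (u : U) (v : EuclideanSpace ℝ (Fin n)) : PiLp 2 fun _ : Fin n => U :=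
  WithLp.toLp 2 fun m => v m • u

theorem inner_tensorVec (u u' : U) (v v' : EuclideanSpace ℝ (Fin n)) :
    ⟪tensorVec u v, tensorVec u' v'⟫ = ⟪u, u'⟫ * ⟪v, v'⟫ := by
  simp only [tensorVec, PiLp.inner_apply, real_inner_smul_left, real_inner_smul_right,
    Finset.mul_sum]
  refine Finset.sum_congr rfl fun m _ => ?_
  simp
  ring

variable [FiniteDimensional ℝ U] [MeasurableSpace U] [BorelSpace U]

/-- Comparison of the bilinear Gaussian process `⟪v ⊗ u, Z⟫` with the linear one
`‖v‖ ⟪u, W₁⟫ + ‖u‖ ⟪v, W₂⟫`. With `‖u‖ ‖v‖ γ` added, where `γ` is an independent standard Gaussian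
variable, the former has the variances `2 ‖u‖² ‖v‖²` of the latter, and its covariances exceed those
of the latter by `(‖u‖ ‖u'‖ - ⟪u, u'⟫) (‖v‖ ‖v'‖ - ⟪v, v'⟫)`. -/
theorem integral_iSup_inner_tensorVec_le (u : ι → U) (v : ι → EuclideanSpace ℝ (Fin n)) :
    ∫ z, ⨆ i, ⟪tensorVec (u i) (v i), z⟫ ∂stdGaussian (PiLp 2 fun _ : Fin n => U) ≤
      ∫ w, ⨆ i, ⟪WithLp.toLp 2 (‖v i‖ • u i, ‖u i‖ • v i), w⟫
        ∂stdGaussian (WithLp 2 (U × EuclideanSpace ℝ (Fin n))) := by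
  refine (integral_iSup_inner_le_prod _ fun i => ‖u i‖ * ‖v i‖).trans (sudakov_fernique fun i j => ?_)
  refine (sq_le_sq₀ (norm_nonneg _) (norm_nonneg _)).1 ?_
  rw [norm_sub_sq_real, norm_sub_sq_real]
  simp only [← real_inner_self_eq_norm_sq, WithLp.prod_inner_apply, inner_tensorVec,
    real_inner_smul_left, real_inner_smul_right]
  simp only [real_inner_self_eq_norm_sq, RCLike.inner_apply, conj_trivial]
  have h := mul_nonneg (sub_nonneg.2 (real_inner_le_norm (u i) (u j)))
    (sub_nonneg.2 (real_inner_le_norm (v i) (v j)))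
  nlinarith

/-- Over the unit balls, the linear process is at most `‖B‖ ‖A* W₁‖ + ‖A‖ ‖B* W₂‖`. -/
theorem integral_iSup_linear_le {A : Ell2 →L[ℝ] U} {B : Ell2 →L[ℝ] EuclideanSpace ℝ (Fin n)}
    (hA : IsHilbertSchmidt A) (hB : IsHilbertSchmidt B) {x y : ι → Ell2} (hx : ∀ i, ‖x i‖ ≤ 1)
    (hy : ∀ i, ‖y i‖ ≤ 1) :
    ∫ w, ⨆ i, ⟪WithLp.toLp 2 (‖B (x i)‖ • A (y i), ‖A (y i)‖ • B (x i)), w⟫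
        ∂stdGaussian (WithLp 2 (U × EuclideanSpace ℝ (Fin n))) ≤
      hsNorm A * ‖B‖ + ‖A‖ * hsNorm B := by
  set e := (WithLp.prodContinuousLinearEquiv 2 ℝ U (EuclideanSpace ℝ (Fin n))).symm.toContinuousLinearMap
  set A' := e ∘L (ContinuousLinearMap.inl ℝ U (EuclideanSpace ℝ (Fin n))) ∘L A with hA'
  set B' := e ∘L (ContinuousLinearMap.inr ℝ U (EuclideanSpace ℝ (Fin n))) ∘L B with hB'
  have eA : ∀ y, A' y = WithLp.toLp 2 (A y, 0) := fun y => rfl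
  have eB : ∀ x, B' x = WithLp.toLp 2 (0, B x) := fun x => rfl
  have nA : hsNorm A' = hsNorm A := by simp [hsNorm, eA]
  have nB : hsNorm B' = hsNorm B := by simp [hsNorm, eB]
  have sA : IsHilbertSchmidt A' := by simpa [IsHilbertSchmidt, eA] using hA
  have sB : IsHilbertSchmidt B' := by simpa [IsHilbertSchmidt, eB] using hB
  have iA := (integrable_norm_continuousLinearMap_stdGaussian A'.adjoint).const_mul ‖B‖
  have iB := (integrable_norm_continuousLinearMap_stdGaussian B'.adjoint).const_mul ‖A‖
  have unit : ∀ {z : Ell2} (w : Ell2), ‖z‖ ≤ 1 → ⟪z, w⟫ ≤ ‖w‖ := fun w hz =>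
    (real_inner_le_norm _ w).trans (mul_le_of_le_one_left (norm_nonneg w) hz)
  have h := integral_mono
    (integrable_iSup_of_integrable fun i => integrable_inner_stdGaussian
      (WithLp.toLp 2 (‖B (x i)‖ • A (y i), ‖A (y i)‖ • B (x i)))) (iA.add iB) fun w => ?_
  · refine h.trans ?_
    rw [integral_add' iA iB, integral_const_mul, integral_const_mul, ← nA, ← nB]
    have h1 := mul_le_mul_of_nonneg_left (integral_norm_adjoint_le A' sA) (norm_nonneg B)
    have h2 := mul_le_mul_of_nonneg_left (integral_norm_adjoint_le B' sB) (norm_nonneg A)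
    linarith
  · refine ciSup_le fun i => ?_
    have e1 : WithLp.toLp 2 (‖B (x i)‖ • A (y i), ‖A (y i)‖ • B (x i))
        = ‖B (x i)‖ • A' (y i) + ‖A (y i)‖ • B' (x i) := by
      rw [eA, eB, ← WithLp.toLp_smul, ← WithLp.toLp_smul, ← WithLp.toLp_add]
      simp
    rw [e1, inner_add_left, real_inner_smul_left, real_inner_smul_left,
      ← ContinuousLinearMap.adjoint_inner_right, ← ContinuousLinearMap.adjoint_inner_right]
    exact add_le_add
      ((mul_le_mul_of_nonneg_left (unit _ (hy i)) (norm_nonneg _)).trans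
        (mul_le_mul_of_nonneg_right (B.unit_le_opNorm _ (hx i)) (norm_nonneg _)))
      ((mul_le_mul_of_nonneg_left (unit _ (hx i)) (norm_nonneg _)).trans
        (mul_le_mul_of_nonneg_right (A.unit_le_opNorm _ (hy i)) (norm_nonneg _)))

end BilinearProcess

/-! ### The square root of the covariance -/

section PosSqrt

variable {C : Ell2 →L[ℝ] Ell2}

theorem inner_self_eq_norm_posSqrt_sq (hC : C.IsPositive) (x : Ell2) :
    ⟪x, C x⟫ = ‖posSqrt C hC x‖ ^ 2 := by
  obtain ⟨hR, hRR⟩ := (exists_positive_sqrt C hC).choose_spec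
  have : C x = posSqrt C hC (posSqrt C hC x) := by
    conv_lhs => rw [← hRR]
    rfl
  rw [this, ← real_inner_self_eq_norm_sq]
  exact (hR.inner_left_eq_inner_right _ _).symm

theorem isHilbertSchmidt_posSqrt (hC : IsTraceClassCovariance C) :
    IsHilbertSchmidt (posSqrt C hC.isPositive) := by
  simpa only [IsHilbertSchmidt, inner_self_eq_norm_posSqrt_sq hC.isPositive]
    using hC.summable_trace

end PosSqrt

/-! ### Gaussian matrices -/

section GaussianMatrix

variable {Ω : Type*} [MeasurableSpace Ω] {P : Measure Ω} {n : ℕ} {C : Ell2 →L[ℝ] Ell2}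
  {G : Ω → Fin n → Ell2}

theorem inner_colOp (g : Fin n → Ell2) (y : Ell2) (v : EuclideanSpace ℝ (Fin n)) :
    ⟪y, colOp g v⟫ = ∑ m, v m * ⟪y, g m⟫ := by
  simp [colOp, inner_sum, real_inner_smul_right]

theorem IsGaussianMatrix.aemeasurable_inner (hG : IsGaussianMatrix P G C) (w : Ell2) (m : Fin n) :
    AEMeasurable (fun ω => ⟪w, G ω m⟫) P :=
  (innerSL ℝ w).continuous.measurable.comp_aemeasurable (hG.aemeasurable m)

theorem IsGaussianMatrix.map_inner (hG : IsGaussianMatrix P G C) (w : Ell2) (m : Fin n) :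
    P.map (fun ω => ⟪w, G ω m⟫) = gaussianReal 0 ⟪w, C w⟫.toNNReal := by
  rw [← hG.law m w]
  exact (AEMeasurable.map_map_of_aemeasurable (innerSL ℝ w).continuous.aemeasurable
    (hG.aemeasurable m)).symm

theorem IsGaussianMatrix.integrable_inner (hG : IsGaussianMatrix P G C) (w : Ell2) (m : Fin n) :
    Integrable (fun ω => ⟪w, G ω m⟫) P := by
  have h : Integrable (fun x : ℝ => x) (P.map fun ω => ⟪w, G ω m⟫) := by
    rw [hG.map_inner]; exact IsGaussian.integrable_id
  exact h.comp_aemeasurable (hG.aemeasurable_inner w m)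

theorem IsGaussianMatrix.integrable_inner_colOp (hG : IsGaussianMatrix P G C) (y : Ell2)
    (v : EuclideanSpace ℝ (Fin n)) : Integrable (fun ω => ⟪y, colOp (G ω) v⟫) P := by
  simp only [inner_colOp]
  exact integrable_finsetSum _ fun m _ => (hG.integrable_inner y m).const_mul _

/-- By independence of the columns, `∑ₘ ⟪wₘ, Gₘ⟫` is centered Gaussian of variance `∑ₘ ‖C^{1/2} wₘ‖²`;
the characteristic function is needed at `1` only, as `w` is arbitrary. -/
theorem IsGaussianMatrix.charFun_sum_inner (hC : C.IsPositive)
    (hG : IsGaussianMatrix P G C) (w : Fin n → Ell2) :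
    charFun (P.map fun ω => ∑ m, ⟪w m, G ω m⟫) 1
      = Complex.exp (-(∑ m, ‖posSqrt C hC (w m)‖ ^ 2 : ℝ) / 2) := by
  have hind : iIndepFun (fun m ω => ⟪w m, G ω m⟫) P :=
    hG.indep.comp (fun m z => ⟪w m, z⟫) fun m => (innerSL ℝ (w m)).continuous.measurable
  rw [hind.charFun_map_fun_sum_eq_prod fun m => hG.aemeasurable_inner (w m) m, Finset.prod_apply]
  simp only [hG.map_inner, charFun_gaussianReal, ← Complex.exp_sum,
    inner_self_eq_norm_posSqrt_sq hC, Real.coe_toNNReal _ (sq_nonneg _)]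
  congr 1
  simp [Finset.sum_div, neg_div]

variable {ι : Type*} [Fintype ι]
variable {U : Type*} [NormedAddCommGroup U] [InnerProductSpace ℝ U] [FiniteDimensional ℝ U]
  [MeasurableSpace U] [BorelSpace U]

/-- The Gaussian family `⟪yᵢ, G vᵢ⟫` has the law of `⟪vᵢ ⊗ uᵢ, Z⟫` with `Z` standard Gaussian, if the
vectors `uᵢ` have the Gram matrix of `C^{1/2} yᵢ`. -/
theorem IsGaussianMatrix.map_inner_colOp [IsProbabilityMeasure P] (hC : C.IsPositive)
    (hG : IsGaussianMatrix P G C) (y : ι → Ell2) (v : ι → EuclideanSpace ℝ (Fin n)) (u : ι → U)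
    (hu : ∀ t : ι → ℝ, ‖∑ i, t i • u i‖ = ‖posSqrt C hC (∑ i, t i • y i)‖) :
    P.map (fun ω i => ⟪y i, colOp (G ω) (v i)⟫) =
      (stdGaussian (PiLp 2 fun _ : Fin n => U)).map fun z i => ⟪tensorVec (u i) (v i), z⟫ := by
  refine map_eq_map_stdGaussian
    (aemeasurable_pi_lambda _ fun i => (hG.integrable_inner_colOp _ _).aemeasurable) _ fun t => ?_
  have e : ∀ ω, ∑ i, t i * ⟪y i, colOp (G ω) (v i)⟫ =
      ∑ m, ⟪∑ i, (t i * v i m) • y i, G ω m⟫ := fun ω => by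
    simp only [inner_colOp, sum_inner, real_inner_smul_left, Finset.mul_sum]
    rw [Finset.sum_comm]
    simp only [mul_assoc]
  simp only [e]
  rw [hG.charFun_sum_inner hC]
  have hn : ‖∑ i, t i • tensorVec (u i) (v i)‖ ^ 2 =
      ∑ m, ‖posSqrt C hC (∑ i, (t i * v i m) • y i)‖ ^ 2 := by
    rw [PiLp.norm_sq_eq_of_L2]
    refine Finset.sum_congr rfl fun m _ => ?_
    rw [← hu]
    simp [tensorVec, smul_smul]
  rw [← Complex.ofReal_pow, hn]

/-- **Chevet's inequality** for a Gaussian matrix with columns of covariance `C`, over finite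
subsets of the unit balls. -/
theorem IsGaussianMatrix.integral_iSup_inner_colOp_le [IsProbabilityMeasure P] [Nonempty ι]
    (hC : IsTraceClassCovariance C) (hG : IsGaussianMatrix P G C)
    {T : Ell2 →L[ℝ] EuclideanSpace ℝ (Fin n)} (hT : IsHilbertSchmidt T) {x y : ι → Ell2}
    (hx : ∀ i, ‖x i‖ ≤ 1) (hy : ∀ i, ‖y i‖ ≤ 1) :
    ∫ ω, ⨆ i, ⟪y i, colOp (G ω) (T (x i))⟫ ∂P ≤
      hsNorm (posSqrt C hC.isPositive) * ‖T‖ + ‖posSqrt C hC.isPositive‖ * hsNorm T := by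
  set R := posSqrt C hC.isPositive with hR
  -- only the finite-dimensional span of the vectors `R yᵢ` matters
  set V : Submodule ℝ Ell2 := Submodule.span ℝ (Set.range fun i => R (y i))
  have hfin : FiniteDimensional ℝ V := FiniteDimensional.span_of_finite ℝ (Set.finite_range _)
  set A : Ell2 →L[ℝ] V := V.orthogonalProjectionOnto ∘L R with hAdef
  have hAy : ∀ i, ((A (y i) : V) : Ell2) = R (y i) := fun i =>
    Submodule.starProjection_eq_self_iff.2 (Submodule.subset_span ⟨i, rfl⟩)
  have hAR : ∀ z, ‖A z‖ ≤ ‖R z‖ := fun z =>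
    (V.orthogonalProjectionOnto.le_of_opNorm_le V.orthogonalProjectionOnto_norm_le
      (R z)).trans_eq (one_mul _)
  have hAn : ‖A‖ ≤ ‖R‖ := ContinuousLinearMap.opNorm_le_bound _ (norm_nonneg _) fun z =>
    (hAR z).trans (R.le_opNorm z)
  have hRs : IsHilbertSchmidt R := isHilbertSchmidt_posSqrt hC
  have hle : ∀ j, ‖A (unitVec j)‖ ^ 2 ≤ ‖R (unitVec j)‖ ^ 2 := fun j =>
    pow_le_pow_left₀ (norm_nonneg _) (hAR _) 2
  have hAs : IsHilbertSchmidt A := Summable.of_nonneg_of_le (fun _ => sq_nonneg _) hle hRs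
  have hAhs : hsNorm A ≤ hsNorm R := Real.sqrt_le_sqrt (hAs.tsum_le_tsum hle hRs)
  have hT0 : 0 ≤ hsNorm T := Real.sqrt_nonneg _
  have hlaw := hG.map_inner_colOp hC.isPositive y (fun i => T (x i)) (fun i => A (y i)) fun t => by
    have h : ((∑ i, t i • A (y i) : V) : Ell2) = R (∑ i, t i • y i) := by simp [hAy]
    rw [← hR, ← h]
    rfl
  have hm : Measurable fun s : ι → ℝ => ⨆ i, s i := Measurable.iSup fun i => measurable_pi_apply i
  have hX : AEMeasurable (fun ω i => ⟪y i, colOp (G ω) (T (x i))⟫) P :=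
    aemeasurable_pi_lambda _ fun i => (hG.integrable_inner_colOp _ _).aemeasurable
  calc ∫ ω, ⨆ i, ⟪y i, colOp (G ω) (T (x i))⟫ ∂P
      = ∫ s, ⨆ i, s i ∂(P.map fun ω i => ⟪y i, colOp (G ω) (T (x i))⟫) :=
        (integral_map hX hm.aestronglyMeasurable).symm
    _ = ∫ z, ⨆ i, ⟪tensorVec (A (y i)) (T (x i)), z⟫ ∂stdGaussian (PiLp 2 fun _ : Fin n => V) := by
        rw [hlaw, integral_map (by fun_prop) hm.aestronglyMeasurable]
    _ ≤ _ := integral_iSup_inner_tensorVec_le _ _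
    _ ≤ hsNorm A * ‖T‖ + ‖A‖ * hsNorm T := integral_iSup_linear_le hAs hT hx hy
    _ ≤ _ := by gcongr

end GaussianMatrix

/-! ### The operator norm as a countable supremum -/

section NormSupremum

/-- The operator norm is the supremum of the bilinear form over a dense sequence of pairs of vectors
of the unit balls. -/
theorem norm_le_of_forall_denseRange {H K : Type*} [NormedAddCommGroup H] [InnerProductSpace ℝ H]
    [NormedAddCommGroup K] [InnerProductSpace ℝ K]
    {d : ℕ → Metric.closedBall (0 : H) 1 × Metric.closedBall (0 : K) 1} (hd : DenseRange d)
    {A : H →L[ℝ] K} {c : ℝ} (h : ∀ k, ⟪((d k).2 : K), A (d k).1⟫ ≤ c) : ‖A‖ ≤ c := by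
  have h1 : ∀ p : Metric.closedBall (0 : H) 1 × Metric.closedBall (0 : K) 1,
      ⟪(p.2 : K), A p.1⟫ ≤ c := fun p =>
    hd.induction_on (p := fun p => ⟪(p.2 : K), A p.1⟫ ≤ c) p
      (isClosed_le (by fun_prop) continuous_const) h
  have hc : 0 ≤ c := by simpa using h1 (⟨0, by simp⟩, ⟨0, by simp⟩)
  refine A.opNorm_le_of_unit_norm hc fun z hz => ?_
  rcases eq_or_ne (A z) 0 with h0 | h0
  · simpa [h0] using hc
  have hn := norm_ne_zero_iff.2 h0
  have := h1 (⟨z, by simp [hz]⟩, ⟨‖A z‖⁻¹ • A z, by simp [norm_smul, hn]⟩)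
  simpa [real_inner_smul_left, real_inner_self_eq_norm_sq, sq, hn] using this

end NormSupremum

/-! ### Passage to the operator norm -/

section OperatorNorm

variable {Ω : Type*} [MeasurableSpace Ω] {P : Measure Ω} {n : ℕ} {C : Ell2 →L[ℝ] Ell2}
  {G : Ω → Fin n → Ell2}

theorem continuous_colOp : Continuous (colOp : (Fin n → Ell2) → _) := by
  unfold colOp
  refine continuous_finsetSum _ fun i _ => ?_
  exact (ContinuousLinearMap.smulRightL ℝ (EuclideanSpace ℝ (Fin n)) Ell2
    (EuclideanSpace.proj i)).continuous.comp (continuous_apply i)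

theorem IsGaussianMatrix.aestronglyMeasurable_norm_comp (hG : IsGaussianMatrix P G C) {H : Type*}
    [NormedAddCommGroup H] [NormedSpace ℝ H] (S : Ell2 →L[ℝ] H)
    (T : Ell2 →L[ℝ] EuclideanSpace ℝ (Fin n)) :
    AEStronglyMeasurable (fun ω => ‖S ∘L colOp (G ω) ∘L T‖) P := by
  have hc : Continuous fun g : Fin n → Ell2 => ‖S ∘L colOp g ∘L T‖ :=
    (continuous_const.clm_comp (continuous_colOp.clm_comp continuous_const)).norm
  exact (hc.measurable.comp_aemeasurable
    (aemeasurable_pi_lambda G hG.aemeasurable)).aestronglyMeasurable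

/-- Chevet's inequality for `G T`, in terms of the Lebesgue integral. -/
theorem IsGaussianMatrix.lintegral_norm_le [IsProbabilityMeasure P]
    (hC : IsTraceClassCovariance C) (hG : IsGaussianMatrix P G C)
    {T : Ell2 →L[ℝ] EuclideanSpace ℝ (Fin n)} (hT : IsHilbertSchmidt T) :
    ∫⁻ ω, ENNReal.ofReal ‖colOp (G ω) ∘L T‖ ∂P ≤ ENNReal.ofReal
      (hsNorm (posSqrt C hC.isPositive) * ‖T‖ + ‖posSqrt C hC.isPositive‖ * hsNorm T) := by
  set B := hsNorm (posSqrt C hC.isPositive) * ‖T‖ + ‖posSqrt C hC.isPositive‖ * hsNorm T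
  have : Nonempty (Metric.closedBall (0 : Ell2) 1) := ⟨⟨0, by simp⟩⟩
  set d : ℕ → Metric.closedBall (0 : Ell2) 1 × Metric.closedBall (0 : Ell2) 1 :=
    TopologicalSpace.denseSeq _
  have hd : DenseRange d := TopologicalSpace.denseRange_denseSeq _
  have hball : ∀ b : Metric.closedBall (0 : Ell2) 1, ‖(b : Ell2)‖ ≤ 1 := fun b =>
    mem_closedBall_zero_iff.1 b.2
  -- `none` stands for the pair `(0, 0)`, which makes the finite maxima nonnegative
  let x : ∀ N, Option (Fin N) → Ell2 := fun N o => o.elim 0 fun k => (d k).1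
  let y : ∀ N, Option (Fin N) → Ell2 := fun N o => o.elim 0 fun k => (d k).2
  have hx : ∀ N o, ‖x N o‖ ≤ 1 := fun N o => by rcases o with _ | k <;> simp [x, hball]
  have hy : ∀ N o, ‖y N o‖ ≤ 1 := fun N o => by rcases o with _ | k <;> simp [y, hball]
  let M : ℕ → Ω → ℝ := fun N ω => ⨆ o, ⟪y N o, colOp (G ω) (T (x N o))⟫
  have le_M : ∀ N ω o, ⟪y N o, colOp (G ω) (T (x N o))⟫ ≤ M N ω := fun N ω o =>
    le_ciSup (f := fun o => ⟪y N o, colOp (G ω) (T (x N o))⟫) (Set.finite_range _).bddAbove o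
  have hM0 : ∀ N ω, 0 ≤ M N ω := fun N ω => by simpa [x, y] using le_M N ω none
  have hMi : ∀ N, Integrable (M N) P := fun N =>
    integrable_iSup_of_integrable fun o => hG.integrable_inner_colOp _ _
  have hmono : ∀ ω, Monotone fun N => M N ω := fun ω N N' hN => by
    refine ciSup_le fun o => ?_
    rcases o with _ | k
    · simpa [y] using hM0 N' ω
    · exact le_M N' ω (some (Fin.castLE hN k))
  calc ∫⁻ ω, ENNReal.ofReal ‖colOp (G ω) ∘L T‖ ∂P
      ≤ ∫⁻ ω, ⨆ N, ENNReal.ofReal (M N ω) ∂P := by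
        refine lintegral_mono fun ω => ?_
        set c := ⨆ N, ENNReal.ofReal (M N ω)
        rcases eq_or_ne c ⊤ with h | h
        · rw [h]; exact le_top
        refine ENNReal.ofReal_le_of_le_toReal (norm_le_of_forall_denseRange hd fun k => ?_)
        refine (le_M (k + 1) ω (some (Fin.last k))).trans ?_
        exact (ENNReal.ofReal_le_iff_le_toReal h).1
          (le_iSup (fun N => ENNReal.ofReal (M N ω)) (k + 1))
    _ = ⨆ N, ∫⁻ ω, ENNReal.ofReal (M N ω) ∂P :=
        lintegral_iSup' (fun N => (hMi N).aemeasurable.ennreal_ofReal)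
          (.of_forall fun ω N N' hN => ENNReal.ofReal_le_ofReal (hmono ω hN))
    _ ≤ ENNReal.ofReal B := by
        refine iSup_le fun N => ?_
        rw [← ofReal_integral_eq_lintegral_ofReal (hMi N) (.of_forall (hM0 N))]
        exact ENNReal.ofReal_le_ofReal (hG.integral_iSup_inner_colOp_le hC hT (hx N) (hy N))

end OperatorNorm

theorem propositionB2 {Ω : Type*} [MeasurableSpace Ω] (P : Measure Ω) [IsProbabilityMeasure P]
    {d n : ℕ} (D : Set (EuclideanSpace ℝ (Fin d)))
    (C : Ell2 →L[ℝ] Ell2) (hC : IsTraceClassCovariance C)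
    (G : Ω → Fin n → Ell2) (hG : IsGaussianMatrix P G C)
    (S : Ell2 →L[ℝ] Lp ℝ 2 (volume.restrict D)) (hS : IsHilbertSchmidt S)
    (T : Ell2 →L[ℝ] EuclideanSpace ℝ (Fin n)) (hT : IsHilbertSchmidt T) :
    Integrable (fun ω => ‖S ∘L colOp (G ω) ∘L T‖) P ∧
      ∫ ω, ‖S ∘L colOp (G ω) ∘L T‖ ∂P ≤
        (hsNorm (posSqrt C hC.isPositive) * ‖T‖ + ‖posSqrt C hC.isPositive‖ * hsNorm T) * ‖S‖ := by
  have hGT := hG.lintegral_norm_le hC hT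
  set B := hsNorm (posSqrt C hC.isPositive) * ‖T‖ + ‖posSqrt C hC.isPositive‖ * hsNorm T
  have hB : 0 ≤ B := add_nonneg (mul_nonneg (Real.sqrt_nonneg _) (norm_nonneg _))
    (mul_nonneg (norm_nonneg _) (Real.sqrt_nonneg _))
  have hm := (hG.aestronglyMeasurable_norm_comp (ContinuousLinearMap.id ℝ Ell2) T)
  simp only [ContinuousLinearMap.id_comp] at hm
  have hi : Integrable (fun ω => ‖colOp (G ω) ∘L T‖) P := by
    refine ⟨hm, ?_⟩
    rw [hasFiniteIntegral_iff_ofReal (.of_forall fun ω => norm_nonneg _)]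
    exact hGT.trans_lt ENNReal.ofReal_lt_top
  have hle : ∀ ω, ‖S ∘L colOp (G ω) ∘L T‖ ≤ ‖colOp (G ω) ∘L T‖ * ‖S‖ := fun ω =>
    (S.opNorm_comp_le _).trans_eq (mul_comm _ _)
  have hiS : Integrable (fun ω => ‖S ∘L colOp (G ω) ∘L T‖) P :=
    (hi.mul_const ‖S‖).mono' (hG.aestronglyMeasurable_norm_comp S T)
      (.of_forall fun ω => by rw [norm_norm]; exact hle ω)
  refine ⟨hiS, (integral_mono hiS (hi.mul_const ‖S‖) hle).trans ?_⟩
  rw [integral_mul_const]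
  refine mul_le_mul_of_nonneg_right ?_ (norm_nonneg _)
  rw [← ENNReal.ofReal_le_ofReal_iff hB,
    ofReal_integral_eq_lintegral_ofReal hi (.of_forall fun ω => norm_nonneg _)]
  exact hGT
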